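/- Setting. There are $K\ge 3$ arms. An environment is a vector of mean rewards $v=(\mu_1,\dots,\mu_K)\in\mathbb R^K$; its set of change points is $\underline x^*_v=\{x\in\{1,\dots,K-1\}:\mu_x\ne\mu_{x+1}\}$, and the size of the change at $x\in \underline x^*_v$ is $\Delta_x=|\mu_x-\mu_{x+1}|$. Let $V_{K,m}$ be the set of environments with exactly $m$ change points in which any two change points $x<y$ satisfy $x+1<y$. In round $t$ the learner plays an arm $a_t$ and observes $y_t=\mu_{a_t}+\epsilon_t$, where the $\epsilon_t$ are i.i.d. $N(0,\sigma^2)$ with $\sigma>0$ known. A (possibly randomized) policy $\pi$ consists of a sampling rule, a stopping rule, which defines a stopping time $\tau$, and a recommendation rule, which returns a set $\hat{\underline x}_\tau$; all of them use only past actions and rewards (and internal randomness independent of the noise). For $\delta\in(0,1)$, $\pi$ is an Any-$(N,\delta)$ policy if $|\hat{\underline x}_\tau|=N$ and, for every $m'\ge N$ and every $v'\in V_{K,m'}$, $$\mathbb P_{\pi,v'}(\hat{\underline x}_\tau\subseteq \underline x^*_{v'})>1-\delta,\qquad \mathbb P_{\pi,v'}(\tau<\infty)=1 .$$ Theorem.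 Let $\delta\in(0,1)$, let $\pi$ be an Any-$(N,\delta)$ policy, and let $v\in V_{K,m}$ with $N\le m<K$, where any two change points $x<y$ of $v$ satisfy $x+2<y$. Let $\Delta_{(1)}\ge\dots\ge\Delta_{(m)}$ be the sizes of the changes of $v$ in decreasing order. Then $$\mathbb E_{\pi,v}[\tau]\;\ge\; 8\sigma^2(1-\delta)\log\!\Big(\frac1{\delta}\Big)\sum_{i=1}^N\frac1{\Delta_{(i)}^2}\;-\;8\sigma^2\log 2\,\sum_{i=1}^m\frac1{\Delta_{(i)}^2}.$$ -/

import Mathlib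

open MeasureTheory ProbabilityTheory
open scoped NNReal ENNReal

noncomputable section

namespace PiecewiseBandit

/-! ### Environments

An environment with `K` arms is its vector of mean rewards `v : Fin K → ℝ`. The arms are numbered
from `0`, and a change point is named by the arm on its left. -/

/-- The set of change points of `v`: the arms `i` that are not the last one and whose mean reward
differs from the mean reward of the next arm. -/
def changePoints {K : ℕ} (v : Fin K → ℝ) : Finset (Fin K) :=
  open Classical in
  Finset.univ.filter fun i => ∃ h : i.val + 1 < K, v i ≠ v ⟨i.val + 1, h⟩

/-- The environments with `K` arms and exactly `m` change points, any two of which are separated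
by at least one action: `x + 1 < y` for change points `x < y`. -/
def environments (K m : ℕ) : Set (Fin K → ℝ) :=
  {v | (changePoints v).card = m ∧
    ∀ x ∈ changePoints v, ∀ y ∈ changePoints v, x < y → x.val + 1 < y.val}

/-- The size `|v i - v (i + 1)|` of the change in mean right after arm `i`
(only used at change points; `0` at the last arm). -/
def jump {K : ℕ} (v : Fin K → ℝ) (i : Fin K) : ℝ :=
  if h : i.val + 1 < K then |v i - v ⟨i.val + 1, h⟩| else 0

/-- The sizes of the changes of `v`, with multiplicity, in decreasing order. -/
def sortedJumps {K : ℕ} (v : Fin K → ℝ) : List ℝ :=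
  ((changePoints v).val.map (jump v)).sort (· ≥ ·)

/-- `orderedJump v i` is the `(i + 1)`-st largest size of a change of `v`, for
`i` smaller than the number of changes. -/
def orderedJump {K : ℕ} (v : Fin K → ℝ) (i : ℕ) : ℝ :=
  (sortedJumps v).getD i 0

/-! ### Policies -/

/-- A (possibly randomized) policy for `K` arms. Before the first round a seed is drawn
from a probability measure; after `n` rounds the policy knows the seed and the
`n` pairs (action, reward) observed so far, and

* `sample n` is the action that it plays next (sampling rule),
* it stops if the seed and the observations lie in `stopSet n` (stopping rule),
* `recommend n` is the estimate that it returns if it stops then (recommendation rule). -/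
structure Policy (K : ℕ) (U : Type*) [MeasurableSpace U] where
  seedLaw : Measure U
  isProbabilityMeasure_seedLaw : IsProbabilityMeasure seedLaw
  sample : ∀ n : ℕ, U × (Fin n → Fin K × ℝ) → Fin K
  measurable_sample : ∀ n, Measurable (sample n)
  stopSet : ∀ n : ℕ, Set (U × (Fin n → Fin K × ℝ))
  measurableSet_stopSet : ∀ n, MeasurableSet (stopSet n)
  recommend : ∀ n : ℕ, U × (Fin n → Fin K × ℝ) → Finset (Fin K)
  measurableSet_recommend : ∀ n S, MeasurableSet {h | recommend n h = S}

variable {K : ℕ} {U : Type*} [MeasurableSpace U]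

/-- The probability space of the interaction: the seed, and independently of it a sequence of
independent `N(0, σ²)` noise variables. -/
def interactionMeasure (π : Policy K U) (σ : ℝ≥0) : Measure (U × (ℕ → ℝ)) :=
  π.seedLaw.prod (Measure.infinitePi fun _ : ℕ => gaussianReal 0 (σ ^ 2))

/-- The actions and rewards of the first `n` rounds, when `π` plays in environment `v` without
ever stopping: in each round the reward is the mean of the action played plus the noise of the
round. -/
def history (π : Policy K U) (v : Fin K → ℝ) (ω : U × (ℕ → ℝ)) :
    (n : ℕ) → (Fin n → Fin K × ℝ)
  | 0 => Fin.elim0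
  | n + 1 =>
      let h := history π v ω n
      let a := π.sample n (ω.1, h)
      Fin.snoc (α := fun _ => Fin K × ℝ) h (a, v a + ω.2 n)

/-- The stopping time `τ`: the first `n` at which the stopping rule holds, `⊤` if there is
none. -/
def stoppingTime (π : Policy K U) (v : Fin K → ℝ) (ω : U × (ℕ → ℝ)) : ℕ∞ :=
  ⨅ (n : ℕ) (_ : (ω.1, history π v ω n) ∈ π.stopSet n), (n : ℕ∞)

/-- The estimate returned at the stopping time (an arbitrary value where `τ = ⊤`). -/
def estimate (π : Policy K U) (v : Fin K → ℝ) (ω : U × (ℕ → ℝ)) : Finset (Fin K) :=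
  let n := (stoppingTime π v ω).toNat
  π.recommend n (ω.1, history π v ω n)

/-- `π` is an Any-`(N, δ)` policy: it recommends sets of size `N`, and in every environment with
at least `N` change points it stops almost surely and returns a set of change points
with probability greater than `1 - δ`. -/
def IsAnyPolicy (π : Policy K U) (σ : ℝ≥0) (N : ℕ) (δ : ℝ) : Prop :=
  (∀ n h, (π.recommend n h).card = N) ∧
  ∀ m : ℕ, N ≤ m → ∀ v ∈ environments K m,
    1 - δ < (interactionMeasure π σ).real {ω | estimate π v ω ⊆ changePoints v} ∧
    interactionMeasure π σ {ω | stoppingTime π v ω < ⊤} = 1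

/-- The expected stopping time `𝔼[τ] ∈ [0, ∞]`. -/
def expectedStoppingTime (π : Policy K U) (σ : ℝ≥0) (v : Fin K → ℝ) : ℝ≥0∞ :=
  ∫⁻ ω, (stoppingTime π v ω : ℝ≥0∞) ∂(interactionMeasure π σ)

end PiecewiseBandit

end

/-! Fix a change point x of `v` and move the arms x and x+1 to the midpoint of their means. The new
environment has no change at x, but it gains one at each neighbour x-1 and x+1 that exists, so it
still has at least m ≥ N change points, and they are still separated. The policy must be correct
there too, so there it recommends x with probability at most δ. The two environments differ only on
the arms x and x+1, each by Δ_x/2. A pull of either carries Kullback-Leibler information Δ_x²/(8σ²),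
and no other pull carries any. Hence recommending x with probability p under `v` requires
(Δ_x²/(8σ²)) · E[number of pulls of x or x+1] ≥ p log(1/δ) - log 2 (`information_inequality`).
Divide by the information per pull and sum over x. The pairs {x, x+1} are disjoint, so the pulls add
up to at most E[τ] (`sum_measure_plays_le`). A correct recommendation contains N change points,
whose reciprocal squared jumps sum to at least those of the N largest jumps, so weighting by p gives
the factor 1-δ (`measure_decides_mul_sum_le`). Everything is done up to a finite horizon n, which
keeps all expectations finite. Since the policy is correct with probability strictly above 1-δ, some
n retains this bound for the event of stopping correctly before n. -/

noncomputable section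

namespace PiecewiseBandit

variable {K : ℕ} {U : Type*} [MeasurableSpace U]

/-! ### Histories -/

/-- The seed together with the history of the first `n` rounds. -/
def information (π : Policy K U) (v : Fin K → ℝ) (n : ℕ) (ω : U × (ℕ → ℝ)) :
    U × (Fin n → Fin K × ℝ) :=
  (ω.1, history π v ω n)

/-- The action played in round `n`. -/
def action (π : Policy K U) (v : Fin K → ℝ) (n : ℕ) (ω : U × (ℕ → ℝ)) : Fin K :=
  π.sample n (information π v n ω)

/-- The information after one more round with noise `e`. -/
def extend (π : Policy K U) (v : Fin K → ℝ) {n : ℕ} (p : U × (Fin n → Fin K × ℝ)) (e : ℝ) :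
    U × (Fin (n + 1) → Fin K × ℝ) :=
  (p.1, Fin.snoc (α := fun _ => Fin K × ℝ) p.2 (π.sample n p, v (π.sample n p) + e))

instance (π : Policy K U) (σ : ℝ≥0) : IsProbabilityMeasure (interactionMeasure π σ) := by
  have := π.isProbabilityMeasure_seedLaw
  unfold interactionMeasure
  infer_instance

lemma information_succ (π : Policy K U) (v : Fin K → ℝ) (n : ℕ) (ω : U × (ℕ → ℝ)) :
    information π v (n + 1) ω = extend π v (information π v n ω) (ω.2 n) := rfl

lemma history_apply (π : Policy K U) (v : Fin K → ℝ) (ω : U × (ℕ → ℝ)) (n : ℕ) (i : Fin n) :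
    history π v ω n i = (action π v i ω, v (action π v i ω) + ω.2 i) := by
  induction n with
  | zero => exact i.elim0
  | succ n ih =>
    refine Fin.lastCases ?_ (fun i => ?_) i
    · simp only [history, Fin.snoc_last]
      rfl
    · simp only [history, Fin.snoc_castSucc]
      exact ih i

lemma history_castLE (π : Policy K U) (v : Fin K → ℝ) (ω : U × (ℕ → ℝ)) {j k : ℕ} (h : j ≤ k) :
    (fun i => history π v ω k (Fin.castLE h i)) = history π v ω j := by
  funext i
  simp [history_apply]

lemma history_congr (π : Policy K U) (v : Fin K → ℝ) (u : U) {x y : ℕ → ℝ} {n : ℕ}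
    (h : ∀ i < n, x i = y i) : history π v (u, x) n = history π v (u, y) n := by
  induction n with
  | zero => rfl
  | succ n ih =>
    simp only [history]
    rw [ih fun i hi => h i (hi.trans n.lt_succ_self), h n n.lt_succ_self]

lemma measurable_extend (π : Policy K U) (v : Fin K → ℝ) (n : ℕ) :
    Measurable fun q : (U × (Fin n → Fin K × ℝ)) × ℝ => extend π v q.1 q.2 := by
  have hs : Measurable fun q : (U × (Fin n → Fin K × ℝ)) × ℝ => π.sample n q.1 :=
    (π.measurable_sample n).comp measurable_fst
  refine measurable_fst.fst.prodMk (measurable_pi_iff.2 fun i => ?_)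
  refine Fin.lastCases ?_ (fun i => ?_) i
  · simp only [Fin.snoc_last]
    exact hs.prodMk (((measurable_of_finite v).comp hs).add measurable_snd)
  · simp only [Fin.snoc_castSucc]
    exact (measurable_pi_apply i).comp measurable_fst.snd

lemma measurable_information (π : Policy K U) (v : Fin K → ℝ) (n : ℕ) :
    Measurable (information π v n) := by
  induction n with
  | zero =>
    refine measurable_fst.prodMk (measurable_pi_iff.2 fun i => i.elim0)
  | succ n ih =>
    exact (measurable_extend π v n).comp
      (ih.prodMk ((measurable_pi_apply n).comp measurable_snd))

lemma measurable_action (π : Policy K U) (v : Fin K → ℝ) (n : ℕ) :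
    Measurable (action π v n) :=
  (π.measurable_sample n).comp (measurable_information π v n)

/-! ### Independence of past and noise -/

lemma map_noise (π : Policy K U) (σ : ℝ≥0) (n : ℕ) :
    (interactionMeasure π σ).map (fun ω => ω.2 n) = gaussianReal 0 (σ ^ 2) := by
  have := π.isProbabilityMeasure_seedLaw
  have h : (fun ω : U × (ℕ → ℝ) => ω.2 n) = (fun x : ℕ → ℝ => x n) ∘ Prod.snd := rfl
  rw [h, ← Measure.map_map (measurable_pi_apply n) measurable_snd, interactionMeasure,
    Measure.map_snd_prod, measure_univ, one_smul]
  exact Measure.infinitePi_map_eval _ n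

/-- What is known after n rounds is a function of the seed and of the noises 0, …, n-1, which are
jointly independent of noise n. -/
lemma indepFun_information_noise (π : Policy K U) (v : Fin K → ℝ) (σ : ℝ≥0) (n : ℕ) :
    IndepFun (information π v n) (fun ω => ω.2 n) (interactionMeasure π σ) := by
  classical
  have := π.isProbabilityMeasure_seedLaw
  set ν : Measure (ℕ → ℝ) := Measure.infinitePi fun _ : ℕ => gaussianReal 0 (σ ^ 2) with hν
  let R : (ℕ → ℝ) → (Finset.range n → ℝ) := fun x i => x i
  have hR : Measurable R := by fun_prop
  -- Padding by zeros is harmless: the first n rounds never read the padded coordinates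
  -- (`history_congr`).
  let ext : (Finset.range n → ℝ) → (ℕ → ℝ) :=
    fun y i => if h : i ∈ Finset.range n then y ⟨i, h⟩ else 0
  have hext : Measurable ext := by
    refine measurable_pi_iff.2 fun i => ?_
    by_cases h : i ∈ Finset.range n
    · simp only [ext, h, dite_true]; fun_prop
    · simp only [ext, h, dite_false]; fun_prop
  have hind : iIndepFun (fun (i : ℕ) (x : ℕ → ℝ) => x i) ν :=
    iIndepFun_infinitePi (X := fun _ x => x) (fun _ => measurable_id)
  have h2 : IndepFun R (fun x : ℕ → ℝ => x n) ν := by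
    have := hind.indepFun_finset (Finset.range n) {n} (by simp)
      (fun i => measurable_pi_apply i)
    exact this.comp (φ := id) (ψ := fun y : ({n} : Finset ℕ) → ℝ => y ⟨n, by simp⟩) measurable_id
      (measurable_pi_apply _)
  have h3 : ν.map (fun x => (R x, x n)) = (ν.map R).prod (gaussianReal 0 (σ ^ 2)) := by
    rw [(indepFun_iff_map_prod_eq_prod_map_map hR.aemeasurable
      (measurable_pi_apply n).aemeasurable).1 h2]
    congr 1
    exact Measure.infinitePi_map_eval _ n
  have : IsProbabilityMeasure (ν.map R) := Measure.isProbabilityMeasure_map hR.aemeasurable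
  have h4 : MeasurePreserving (fun x => (R x, x n)) ν ((ν.map R).prod (gaussianReal 0 (σ ^ 2))) :=
    ⟨by fun_prop, h3⟩
  have h5 := (measurePreserving_prodAssoc π.seedLaw (ν.map R) (gaussianReal 0 (σ ^ 2))).symm.comp
    ((MeasurePreserving.id π.seedLaw).prod h4)
  have h6 : IndepFun (fun ω : U × (ℕ → ℝ) => (ω.1, R ω.2)) (fun ω => ω.2 n)
      (interactionMeasure π σ) := by
    rw [indepFun_iff_map_prod_eq_prod_map_map (by fun_prop) (by fun_prop), map_noise]
    have h7 : (interactionMeasure π σ).map (fun ω => (ω.1, R ω.2))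
        = π.seedLaw.prod (ν.map R) :=
      ((MeasurePreserving.id π.seedLaw).prod (⟨hR, rfl⟩ : MeasurePreserving R ν (ν.map R))).map_eq
    rw [h7]
    exact h5.map_eq
  have h8 : information π v n
      = (fun p => information π v n (p.1, ext p.2)) ∘ fun ω : U × (ℕ → ℝ) => (ω.1, R ω.2) := by
    funext ω
    refine Prod.ext rfl (history_congr π v ω.1 fun i hi => ?_)
    simp [ext, R, hi]
  rw [h8]
  exact h6.comp (ψ := id) ((measurable_information π v n).comp
    (measurable_fst.prodMk (hext.comp measurable_snd))) measurable_id

lemma lintegral_information_noise (π : Policy K U) (v : Fin K → ℝ) (σ : ℝ≥0) (n : ℕ)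
    {F : (U × (Fin n → Fin K × ℝ)) × ℝ → ℝ≥0∞} (hF : Measurable F) :
    ∫⁻ ω, F (information π v n ω, ω.2 n) ∂(interactionMeasure π σ) =
      ∫⁻ ω, ∫⁻ e, F (information π v n ω, e) ∂(gaussianReal 0 (σ ^ 2))
        ∂(interactionMeasure π σ) := by
  have hn : Measurable fun ω : U × (ℕ → ℝ) => ω.2 n := by fun_prop
  have h := (indepFun_iff_map_prod_eq_prod_map_map
    (measurable_information π v n).aemeasurable hn.aemeasurable).1
    (indepFun_information_noise π v σ n)
  rw [← lintegral_map hF ((measurable_information π v n).prodMk hn), h, map_noise,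
    lintegral_prod _ hF.aemeasurable,
    lintegral_map hF.lintegral_prod_right' (measurable_information π v n)]

/-! ### Change of measure -/

/-- The log-likelihood ratio of `v'` with respect to `v` of one observation. -/
def logRatio (v v' : Fin K → ℝ) (σ : ℝ≥0) (o : Fin K × ℝ) : ℝ :=
  ((o.2 - v o.1) ^ 2 - (o.2 - v' o.1) ^ 2) / (2 * (σ : ℝ) ^ 2)

lemma measurable_logRatio (v v' : Fin K → ℝ) (σ : ℝ≥0) : Measurable (logRatio v v' σ) := by
  have h (w : Fin K → ℝ) : Measurable fun o : Fin K × ℝ => w o.1 :=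
    (measurable_of_finite w).comp measurable_fst
  exact (((measurable_snd.sub (h v)).pow_const 2).sub
    ((measurable_snd.sub (h v')).pow_const 2)).div_const _

/-- The exponent is left unsimplified so that it is literally `logRatio` at an observation with
reward `a + e`. -/
lemma lintegral_gaussian_shift (σ : ℝ≥0) (hσ : 0 < σ) (a b : ℝ) {f : ℝ → ℝ≥0∞}
    (hf : Measurable f) :
    ∫⁻ e, f (b + e) ∂(gaussianReal 0 (σ ^ 2)) =
      ∫⁻ e, f (a + e) * ENNReal.ofReal
        (Real.exp (((a + e - a) ^ 2 - (a + e - b) ^ 2) / (2 * (σ : ℝ) ^ 2)))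
        ∂(gaussianReal 0 (σ ^ 2)) := by
  have hσ2 : σ ^ 2 ≠ 0 := by positivity
  have key (c : ℝ) {g : ℝ → ℝ≥0∞} (hg : Measurable g) :
      ∫⁻ e, g (c + e) ∂(gaussianReal 0 (σ ^ 2)) =
        ∫⁻ y, gaussianPDF c (σ ^ 2) y * g y := by
    rw [← lintegral_map hg (measurable_const_add c), gaussianReal_map_const_add, zero_add,
      gaussianReal_of_var_ne_zero _ hσ2,
      lintegral_withDensity_eq_lintegral_mul _ (measurable_gaussianPDF _ _) hg]
    rfl
  rw [key b hf, key a (g := fun y => f y * ENNReal.ofReal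
    (Real.exp (((y - a) ^ 2 - (y - b) ^ 2) / (2 * (σ : ℝ) ^ 2)))) (by fun_prop)]
  refine lintegral_congr fun y => ?_
  rw [mul_left_comm, mul_comm, gaussianPDF, gaussianPDF,
    ← ENNReal.ofReal_mul (gaussianPDFReal_nonneg _ _ _)]
  congr 2
  have : (σ : ℝ) ≠ 0 := by positivity
  rw [gaussianPDFReal, gaussianPDFReal, mul_assoc _ (Real.exp _), ← Real.exp_add]
  congr 2
  push_cast
  field_simp
  ring

/-- The likelihood ratio of the histories of length `n`. -/
def likelihood (v v' : Fin K → ℝ) (σ : ℝ≥0) {n : ℕ} (p : U × (Fin n → Fin K × ℝ)) : ℝ≥0∞ :=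
  ENNReal.ofReal (Real.exp (∑ i, logRatio v v' σ (p.2 i)))

lemma measurable_likelihood (v v' : Fin K → ℝ) (σ : ℝ≥0) (n : ℕ) :
    Measurable (likelihood (U := U) (n := n) v v' σ) := by
  refine (Real.measurable_exp.comp (Finset.measurable_sum _ fun i _ => ?_)).ennreal_ofReal
  exact (measurable_logRatio v v' σ).comp ((measurable_pi_apply i).comp measurable_snd)

lemma likelihood_extend (π : Policy K U) (v v' : Fin K → ℝ) (σ : ℝ≥0) {n : ℕ}
    (p : U × (Fin n → Fin K × ℝ)) (e : ℝ) :
    likelihood v v' σ (extend π v p e) = likelihood v v' σ p *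
      ENNReal.ofReal (Real.exp (logRatio v v' σ (π.sample n p, v (π.sample n p) + e))) := by
  simp only [likelihood, extend, Fin.sum_univ_castSucc, Fin.snoc_castSucc, Fin.snoc_last,
    Real.exp_add]
  exact ENNReal.ofReal_mul (Real.exp_pos _).le

/-- All environments live on one probability space and only the history map depends on the means, so
the change of measure compares the laws of two maps instead of two measures. -/
theorem lintegral_change_of_measure (π : Policy K U) (v v' : Fin K → ℝ) (σ : ℝ≥0) (hσ : 0 < σ)
    (n : ℕ) {F : U × (Fin n → Fin K × ℝ) → ℝ≥0∞} (hF : Measurable F) :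
    ∫⁻ ω, F (information π v' n ω) ∂(interactionMeasure π σ) =
      ∫⁻ ω, F (information π v n ω) * likelihood v v' σ (information π v n ω)
        ∂(interactionMeasure π σ) := by
  induction n with
  | zero =>
    refine lintegral_congr fun ω => ?_
    simp only [likelihood, Finset.univ_eq_empty, Finset.sum_empty, Real.exp_zero,
      ENNReal.ofReal_one, mul_one]
    rfl
  | succ n ih =>
    have hv' : Measurable fun q : (U × (Fin n → Fin K × ℝ)) × ℝ => F (extend π v' q.1 q.2) :=
      hF.comp (measurable_extend π v' n)
    have hL := measurable_likelihood (U := U) v v' σ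
    simp only [information_succ]
    -- Integrate out the last noise on both sides and apply the induction hypothesis to the
    -- resulting function of the past. What remains, for a fixed past, is a Gaussian shift between
    -- the two means of the next action.
    rw [lintegral_information_noise π v' σ n hv', ih hv'.lintegral_prod_right',
      lintegral_information_noise π v σ n (F := fun q => F (extend π v q.1 q.2) *
        likelihood v v' σ (extend π v q.1 q.2))
        ((hF.mul (hL _)).comp (measurable_extend π v n))]
    refine lintegral_congr fun ω => ?_
    set p := information π v n ω
    have hf : Measurable fun y : ℝ => F (p.1, Fin.snoc (α := fun _ => Fin K × ℝ) p.2
        (π.sample n p, y)) := by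
      refine hF.comp (measurable_const.prodMk (measurable_pi_iff.2 fun i => ?_))
      refine Fin.lastCases ?_ (fun i => ?_) i
      · simp only [Fin.snoc_last]
        exact measurable_const.prodMk measurable_id
      · simp only [Fin.snoc_castSucc]
        exact measurable_const
    have h := lintegral_gaussian_shift σ hσ (v (π.sample n p)) (v' (π.sample n p)) hf
    rw [show ∫⁻ e, F (extend π v' p e) ∂(gaussianReal 0 (σ ^ 2)) = _ from h,
      ← lintegral_mul_const']
    · refine lintegral_congr fun e => ?_
      rw [likelihood_extend, mul_assoc, mul_comm (ENNReal.ofReal _)]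
      rfl
    · exact ENNReal.ofReal_ne_top

/-! ### Stopping -/

/-- The information after `n` rounds under which `π` has not stopped before round `n`. -/
def unstopped (π : Policy K U) (n : ℕ) : Set (U × (Fin n → Fin K × ℝ)) :=
  {p | ∀ j (hj : j < n), (p.1, fun i => p.2 (Fin.castLE hj.le i)) ∉ π.stopSet j}

lemma measurableSet_unstopped (π : Policy K U) (n : ℕ) : MeasurableSet (unstopped π n) := by
  simp only [unstopped, Set.ofPred_forall]
  refine MeasurableSet.iInter fun j => MeasurableSet.iInter fun hj => ?_
  have h : Measurable fun p : U × (Fin n → Fin K × ℝ) =>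
      ((p.1, fun i => p.2 (Fin.castLE hj.le i)) : U × (Fin j → Fin K × ℝ)) :=
    measurable_fst.prodMk (measurable_pi_iff.2 fun i =>
      (measurable_pi_apply (Fin.castLE hj.le i)).comp measurable_snd)
  exact (h (π.measurableSet_stopSet j)).compl

lemma information_mem_unstopped (π : Policy K U) (v : Fin K → ℝ) (n : ℕ) (ω : U × (ℕ → ℝ)) :
    information π v n ω ∈ unstopped π n ↔ (n : ℕ∞) ≤ stoppingTime π v ω := by
  simp only [unstopped, information, Set.mem_ofPred_eq, history_castLE, stoppingTime, le_iInf_iff,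
    Nat.cast_le]
  exact ⟨fun h j hj => not_lt.1 fun hlt => h j hlt hj, fun h j hj hs => (h j hs).not_gt hj⟩

lemma stoppingTime_le (π : Policy K U) (v : Fin K → ℝ) {n : ℕ} {ω : U × (ℕ → ℝ)}
    (h : information π v n ω ∈ π.stopSet n) : stoppingTime π v ω ≤ n :=
  iInf₂_le n h

lemma stoppingTime_eq_iff (π : Policy K U) (v : Fin K → ℝ) (n : ℕ) (ω : U × (ℕ → ℝ)) :
    stoppingTime π v ω = n ↔
      information π v n ω ∈ unstopped π n ∧ information π v n ω ∈ π.stopSet n := by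
  constructor
  · intro h
    refine ⟨(information_mem_unstopped π v n ω).2 h.ge, ?_⟩
    by_contra hn
    have : (n + 1 : ℕ) ≤ stoppingTime π v ω := by
      refine le_iInf₂ fun j hj => Nat.cast_le.2 ?_
      have h1 : (n : ℕ∞) ≤ j := h ▸ iInf₂_le j hj
      rcases (Nat.cast_le.1 h1).eq_or_lt with rfl | h2
      · exact absurd hj hn
      · exact h2
    rw [h, Nat.cast_le] at this
    omega
  · rintro ⟨h1, h2⟩
    exact (stoppingTime_le π v h2).antisymm ((information_mem_unstopped π v n ω).1 h1)

lemma lt_stoppingTime_iff (π : Policy K U) (v : Fin K → ℝ) (n : ℕ) (ω : U × (ℕ → ℝ)) :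
    (n : ℕ∞) < stoppingTime π v ω ↔
      information π v n ω ∈ unstopped π n \ π.stopSet n := by
  rw [lt_iff_le_and_ne, ← information_mem_unstopped, ne_comm, Ne, stoppingTime_eq_iff,
    Set.mem_sdiff]
  tauto

lemma measurableSet_lt_stoppingTime (π : Policy K U) (v : Fin K → ℝ) (n : ℕ) :
    MeasurableSet {ω | (n : ℕ∞) < stoppingTime π v ω} := by
  simp only [lt_stoppingTime_iff]
  exact measurable_information π v n
    ((measurableSet_unstopped π n).diff (π.measurableSet_stopSet n))

/-! ### The stopped likelihood ratio -/

/-- The log-likelihood ratio of the rounds before `n` and before the stopping time. -/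
def stoppedLogRatio (π : Policy K U) (v v' : Fin K → ℝ) (σ : ℝ≥0) (n : ℕ)
    (ω : U × (ℕ → ℝ)) : ℝ :=
  ∑ t ∈ Finset.range n, if (t : ℕ∞) < stoppingTime π v ω then
    logRatio v v' σ (action π v t ω, v (action π v t ω) + ω.2 t) else 0

/-- The difference of the means of the action of round `n` in two environments; `0` from the
stopping time on. -/
def drift (π : Policy K U) (v v' : Fin K → ℝ) (n : ℕ) (ω : U × (ℕ → ℝ)) : ℝ :=
  if (n : ℕ∞) < stoppingTime π v ω then v (action π v n ω) - v' (action π v n ω) else 0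

lemma likelihood_eq_of_min_eq (π : Policy K U) (v v' : Fin K → ℝ) (σ : ℝ≥0) {n k : ℕ}
    {ω : U × (ℕ → ℝ)} (h : min (stoppingTime π v ω) n = k) :
    likelihood v v' σ (information π v k ω) =
      ENNReal.ofReal (Real.exp (stoppedLogRatio π v v' σ n ω)) := by
  have hkn : k ≤ n := by
    have := min_le_right (stoppingTime π v ω) (n : ℕ∞)
    rw [h, Nat.cast_le] at this
    exact this
  unfold likelihood stoppedLogRatio
  congr 2
  simp only [information, history_apply]
  rw [Fin.sum_univ_eq_sum_range
    (fun t => logRatio v v' σ (action π v t ω, v (action π v t ω) + ω.2 t)) k,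
    ← Finset.sum_subset (Finset.range_subset_range.2 hkn)]
  · refine Finset.sum_congr rfl fun t ht => (if_pos ?_).symm
    have h1 : (k : ℕ∞) ≤ stoppingTime π v ω := h ▸ min_le_left _ _
    exact lt_of_lt_of_le (Nat.cast_lt.2 (Finset.mem_range.1 ht)) h1
  · intro t ht htk
    refine if_neg fun hlt => htk (Finset.mem_range.2 ?_)
    have h1 : (t : ℕ∞) < k :=
      h ▸ lt_min hlt (Nat.cast_lt.2 (Finset.mem_range.1 ht))
    exact Nat.cast_lt.1 h1

/-- The event is split according to the value k of min(τ, n). On each piece the stopped likelihood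
ratio is that of the first k rounds, so the fixed-time change of measure applies. The sets `B k`
constrain histories, hence serve both environments. -/
theorem lintegral_stopped_change_of_measure (π : Policy K U) (v v' : Fin K → ℝ) (σ : ℝ≥0)
    (hσ : 0 < σ) (n : ℕ) (B : ∀ k, Set (U × (Fin k → Fin K × ℝ)))
    (hB : ∀ k, MeasurableSet (B k))
    (hmin : ∀ w ω k, information π w k ω ∈ B k → min (stoppingTime π w ω) n = k) :
    ∫⁻ ω in ⋃ k ∈ Finset.range (n + 1), information π v k ⁻¹' B k,
        ENNReal.ofReal (Real.exp (stoppedLogRatio π v v' σ n ω)) ∂(interactionMeasure π σ) =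
      interactionMeasure π σ (⋃ k ∈ Finset.range (n + 1), information π v' k ⁻¹' B k) := by
  have hm (w : Fin K → ℝ) (k : ℕ) : MeasurableSet (information π w k ⁻¹' B k) :=
    measurable_information π w k (hB k)
  have hd (w : Fin K → ℝ) : Set.PairwiseDisjoint (Finset.range (n + 1) : Set ℕ)
      fun k => information π w k ⁻¹' B k := by
    intro j _ k _ hjk
    refine Set.disjoint_left.2 fun ω hj hk => hjk ?_
    exact Nat.cast_injective ((hmin w ω j hj).symm.trans (hmin w ω k hk))
  rw [lintegral_biUnion_finset (hd v) fun k _ => hm v k,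
    measure_biUnion_finset (hd v') fun k _ => hm v' k]
  refine Finset.sum_congr rfl fun k _ => ?_
  rw [← lintegral_indicator_one (hm v' k)]
  have h := lintegral_change_of_measure π v v' σ hσ k
    (F := (B k).indicator 1) (measurable_one.indicator (hB k))
  refine Eq.trans ?_ h.symm
  rw [← lintegral_indicator (hm v k)]
  refine lintegral_congr fun ω => ?_
  by_cases hω : information π v k ω ∈ B k
  · rw [Set.indicator_of_mem (show ω ∈ information π v k ⁻¹' B k from hω),
      Set.indicator_of_mem hω, Pi.one_apply, one_mul,
      likelihood_eq_of_min_eq π v v' σ (hmin v ω k hω)]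
  · rw [Set.indicator_of_notMem (show ω ∉ information π v k ⁻¹' B k from hω),
      Set.indicator_of_notMem hω, zero_mul]

theorem lintegral_exp_stoppedLogRatio (π : Policy K U) (v v' : Fin K → ℝ) (σ : ℝ≥0)
    (hσ : 0 < σ) (n : ℕ) :
    ∫⁻ ω, ENNReal.ofReal (Real.exp (stoppedLogRatio π v v' σ n ω)) ∂(interactionMeasure π σ) =
      1 := by
  -- These are the histories with min(τ, n) = k; at k = n stopping is not required. They exhaust the
  -- space.
  let B : ∀ k, Set (U × (Fin k → Fin K × ℝ)) := fun k =>
    {p | k ≤ n ∧ p ∈ unstopped π k ∧ (k < n → p ∈ π.stopSet k)}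
  have hB (k : ℕ) : MeasurableSet (B k) :=
    (MeasurableSet.const _).inter ((measurableSet_unstopped π k).inter
      ((MeasurableSet.const (k < n)).imp (π.measurableSet_stopSet k)))
  have hmin (w : Fin K → ℝ) (ω : U × (ℕ → ℝ)) (k : ℕ) (h : information π w k ω ∈ B k) :
      min (stoppingTime π w ω) n = k := by
    obtain ⟨h1, h2, h3⟩ := h
    rcases h1.eq_or_lt with rfl | h4
    · exact min_eq_right ((information_mem_unstopped π w _ ω).1 h2)
    · rw [(stoppingTime_eq_iff π w k ω).2 ⟨h2, h3 h4⟩]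
      exact min_eq_left (Nat.cast_le.2 h1)
  have huniv (w : Fin K → ℝ) :
      ⋃ k ∈ Finset.range (n + 1), information π w k ⁻¹' B k = Set.univ := by
    refine Set.eq_univ_of_forall fun ω => ?_
    simp only [Set.mem_iUnion, Finset.mem_range, Set.mem_preimage]
    rcases lt_or_ge (stoppingTime π w ω) n with h | h
    · obtain ⟨k, hk⟩ := ENat.ne_top_iff_exists.1 (h.ne_top)
      have hkn : k < n := by rwa [← hk, Nat.cast_lt] at h
      have := (stoppingTime_eq_iff π w k ω).1 hk.symm
      exact ⟨k, by omega, hkn.le, this.1, fun _ => this.2⟩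
    · exact ⟨n, n.lt_succ_self, le_rfl, (information_mem_unstopped π w n ω).2 h,
        fun h => absurd h (lt_irrefl n)⟩
  have h := lintegral_stopped_change_of_measure π v v' σ hσ n B hB hmin
  rw [huniv, huniv, measure_univ, Measure.restrict_univ] at h
  exact h

/-- The event that `π` stops before round `n` and recommends a set with property `P`. -/
def decides (π : Policy K U) (v : Fin K → ℝ) (n : ℕ) (P : Finset (Fin K) → Prop) :
    Set (U × (ℕ → ℝ)) :=
  {ω | stoppingTime π v ω < n ∧ P (estimate π v ω)}

/-- The information after `k < n` rounds under which `π` stops and recommends a set with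
property `P`. -/
def decisionSet (π : Policy K U) (n : ℕ) (P : Finset (Fin K) → Prop) (k : ℕ) :
    Set (U × (Fin k → Fin K × ℝ)) :=
  {p | k < n ∧ (p ∈ unstopped π k ∧ p ∈ π.stopSet k) ∧ P (π.recommend k p)}

lemma measurableSet_decisionSet (π : Policy K U) (n : ℕ) (P : Finset (Fin K) → Prop) (k : ℕ) :
    MeasurableSet (decisionSet π n P k) := by
  have h : {p | P (π.recommend k p)} = ⋃ S ∈ {S | P S}, {p | π.recommend k p = S} := by
    ext p; simp
  have h' : MeasurableSet {p | P (π.recommend k p)} := by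
    rw [h]
    exact MeasurableSet.biUnion (Set.to_countable _) fun S _ => π.measurableSet_recommend k S
  exact (MeasurableSet.const _).inter
    (((measurableSet_unstopped π k).inter (π.measurableSet_stopSet k)).inter h')

lemma estimate_of_stoppingTime_eq (π : Policy K U) (v : Fin K → ℝ) {k : ℕ}
    {ω : U × (ℕ → ℝ)} (h : stoppingTime π v ω = k) :
    estimate π v ω = π.recommend k (information π v k ω) := by
  simp only [estimate]
  rw [h]
  rfl

lemma information_mem_decisionSet (π : Policy K U) (v : Fin K → ℝ) (n : ℕ)
    (P : Finset (Fin K) → Prop) (k : ℕ) (ω : U × (ℕ → ℝ)) :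
    information π v k ω ∈ decisionSet π n P k ↔
      stoppingTime π v ω = k ∧ ω ∈ decides π v n P := by
  simp only [decisionSet, decides, Set.mem_ofPred_eq, ← stoppingTime_eq_iff]
  constructor
  · rintro ⟨h1, h2, h3⟩
    refine ⟨h2, by rw [h2]; exact_mod_cast h1, ?_⟩
    rwa [estimate_of_stoppingTime_eq π v h2]
  · rintro ⟨h2, h1, h3⟩
    refine ⟨by rw [h2] at h1; exact_mod_cast h1, h2, ?_⟩
    rwa [← estimate_of_stoppingTime_eq π v h2]

lemma decides_eq_biUnion (π : Policy K U) (v : Fin K → ℝ) (n : ℕ)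
    (P : Finset (Fin K) → Prop) :
    decides π v n P =
      ⋃ k ∈ Finset.range (n + 1), information π v k ⁻¹' decisionSet π n P k := by
  ext ω
  simp only [Set.mem_iUnion, Finset.mem_range, Set.mem_preimage, information_mem_decisionSet]
  constructor
  · intro h
    obtain ⟨k, hk⟩ := ENat.ne_top_iff_exists.1 h.1.ne_top
    have : (k : ℕ∞) < n := hk ▸ h.1
    exact ⟨k, (Nat.cast_lt.1 this).trans n.lt_succ_self, hk.symm, h⟩
  · rintro ⟨k, -, -, h⟩
    exact h

lemma measurableSet_decides (π : Policy K U) (v : Fin K → ℝ) (n : ℕ)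
    (P : Finset (Fin K) → Prop) : MeasurableSet (decides π v n P) := by
  rw [decides_eq_biUnion]
  exact Finset.measurableSet_biUnion _ fun k _ =>
    measurable_information π v k (measurableSet_decisionSet π n P k)

theorem setLIntegral_exp_stoppedLogRatio (π : Policy K U) (v v' : Fin K → ℝ) (σ : ℝ≥0)
    (hσ : 0 < σ) (n : ℕ) (P : Finset (Fin K) → Prop) :
    ∫⁻ ω in decides π v n P,
        ENNReal.ofReal (Real.exp (stoppedLogRatio π v v' σ n ω)) ∂(interactionMeasure π σ) =
      interactionMeasure π σ (decides π v' n P) := by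
  rw [decides_eq_biUnion, decides_eq_biUnion]
  refine lintegral_stopped_change_of_measure π v v' σ hσ n _
    (measurableSet_decisionSet π n P) fun w ω k h => ?_
  obtain ⟨h1, h2⟩ := (information_mem_decisionSet π w n P k ω).1 h
  rw [min_eq_left h2.1.le, h1]

/-! ### The information inequality -/

lemma exists_drift_eq (π : Policy K U) (v v' : Fin K → ℝ) (n : ℕ) :
    ∃ G : U × (Fin n → Fin K × ℝ) → ℝ, Measurable G ∧ drift π v v' n = G ∘ information π v n := by
  classical
  refine ⟨fun p => if p ∈ unstopped π n \ π.stopSet n then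
    v (π.sample n p) - v' (π.sample n p) else 0, ?_, ?_⟩
  · refine Measurable.ite ((measurableSet_unstopped π n).diff (π.measurableSet_stopSet n)) ?_
      measurable_const
    exact (measurable_of_finite fun a => v a - v' a).comp (π.measurable_sample n)
  · funext ω
    simp only [drift, lt_stoppingTime_iff, action, Function.comp_apply]

lemma measurable_drift (π : Policy K U) (v v' : Fin K → ℝ) (n : ℕ) :
    Measurable (drift π v v' n) := by
  obtain ⟨G, hG, h⟩ := exists_drift_eq π v v' n
  exact h ▸ hG.comp (measurable_information π v n)

lemma abs_drift_le (π : Policy K U) (v v' : Fin K → ℝ) (n : ℕ) (ω : U × (ℕ → ℝ)) :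
    |drift π v v' n ω| ≤ ∑ a, |v a - v' a| := by
  unfold drift
  split_ifs
  · exact Finset.single_le_sum (f := fun a => |v a - v' a|) (fun _ _ => abs_nonneg _)
      (Finset.mem_univ _)
  · rw [abs_zero]
    exact Finset.sum_nonneg fun _ _ => abs_nonneg _

lemma integrable_drift_sq (π : Policy K U) (v v' : Fin K → ℝ) (σ : ℝ≥0) (n : ℕ) :
    Integrable (fun ω => drift π v v' n ω ^ 2) (interactionMeasure π σ) := by
  refine Integrable.of_bound ((measurable_drift π v v' n).pow_const 2).aestronglyMeasurable
    ((∑ a, |v a - v' a|) ^ 2) (ae_of_all _ fun ω => ?_)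
  rw [Real.norm_eq_abs, abs_pow]
  exact pow_le_pow_left₀ (abs_nonneg _) (abs_drift_le π v v' n ω) 2

lemma integrable_drift (π : Policy K U) (v v' : Fin K → ℝ) (σ : ℝ≥0) (n : ℕ) :
    Integrable (drift π v v' n) (interactionMeasure π σ) :=
  Integrable.of_bound (measurable_drift π v v' n).aestronglyMeasurable _
    (ae_of_all _ (abs_drift_le π v v' n))

lemma integrable_noise (π : Policy K U) (σ : ℝ≥0) (n : ℕ) :
    Integrable (fun ω => ω.2 n) (interactionMeasure π σ) := by
  have hm : Measurable fun ω : U × (ℕ → ℝ) => ω.2 n := by fun_prop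
  have h : Integrable (fun x : ℝ => x) (gaussianReal 0 (σ ^ 2)) :=
    (memLp_id_gaussianReal 1).integrable le_rfl
  rw [← map_noise π σ n] at h
  exact (integrable_map_measure (by fun_prop) hm.aemeasurable).1 h

lemma integral_noise (π : Policy K U) (σ : ℝ≥0) (n : ℕ) :
    ∫ ω, ω.2 n ∂(interactionMeasure π σ) = 0 := by
  have hm : Measurable fun ω : U × (ℕ → ℝ) => ω.2 n := by fun_prop
  rw [← integral_map (f := fun x : ℝ => x) hm.aemeasurable (by fun_prop), map_noise,
    integral_id_gaussianReal]

lemma indepFun_drift_noise (π : Policy K U) (v v' : Fin K → ℝ) (σ : ℝ≥0) (n : ℕ) :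
    IndepFun (drift π v v' n) (fun ω => ω.2 n) (interactionMeasure π σ) := by
  obtain ⟨G, hG, h⟩ := exists_drift_eq π v v' n
  rw [h]
  exact (indepFun_information_noise π v σ n).comp (ψ := id) hG measurable_id

lemma stoppedLogRatio_eq (π : Policy K U) (v v' : Fin K → ℝ) (σ : ℝ≥0) (n : ℕ)
    (ω : U × (ℕ → ℝ)) :
    stoppedLogRatio π v v' σ n ω = ∑ t ∈ Finset.range n,
      -((2 * (drift π v v' t ω * ω.2 t) + drift π v v' t ω ^ 2) / (2 * (σ : ℝ) ^ 2)) := by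
  refine Finset.sum_congr rfl fun t _ => ?_
  unfold drift logRatio
  split_ifs
  · ring
  · simp

lemma integrable_stoppedLogRatio (π : Policy K U) (v v' : Fin K → ℝ) (σ : ℝ≥0) (n : ℕ) :
    Integrable (stoppedLogRatio π v v' σ n) (interactionMeasure π σ) := by
  simp only [funext (stoppedLogRatio_eq π v v' σ n)]
  exact integrable_finsetSum _ fun t _ => (((((indepFun_drift_noise π v v' σ t).integrable_mul
    (integrable_drift π v v' σ t) (integrable_noise π σ t)).const_mul 2).add
    (integrable_drift_sq π v v' σ t)).div_const _).neg

/-- The drift of round t is determined before the noise of round t, so the cross terms have mean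
zero and minus the divergence remains. -/
lemma integral_stoppedLogRatio (π : Policy K U) (v v' : Fin K → ℝ) (σ : ℝ≥0) (n : ℕ) :
    ∫ ω, stoppedLogRatio π v v' σ n ω ∂(interactionMeasure π σ) =
      -((∑ t ∈ Finset.range n, ∫ ω, drift π v v' t ω ^ 2 ∂(interactionMeasure π σ)) /
        (2 * (σ : ℝ) ^ 2)) := by
  have h1 (t : ℕ) : Integrable (fun ω => 2 * (drift π v v' t ω * ω.2 t))
      (interactionMeasure π σ) :=
    ((indepFun_drift_noise π v v' σ t).integrable_mul
      (integrable_drift π v v' σ t) (integrable_noise π σ t)).const_mul 2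
  have h2 (t : ℕ) := integrable_drift_sq π v v' σ t
  simp only [stoppedLogRatio_eq]
  have h3 (t : ℕ) : Integrable (fun ω => -((2 * (drift π v v' t ω * ω.2 t) +
      drift π v v' t ω ^ 2) / (2 * (σ : ℝ) ^ 2))) (interactionMeasure π σ) :=
    (((h1 t).add (h2 t)).div_const _).neg
  rw [integral_finsetSum _ fun t _ => h3 t,
    Finset.sum_div, ← Finset.sum_neg_distrib]
  refine Finset.sum_congr rfl fun t _ => ?_
  rw [integral_neg, integral_div, integral_add (h1 t) (h2 t), integral_const_mul,
    (indepFun_drift_noise π v v' σ t).integral_fun_mul_eq_mul_integral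
      (measurable_drift π v v' t).aestronglyMeasurable
      (integrable_noise π σ t).aestronglyMeasurable, integral_noise, mul_zero, mul_zero, zero_add]

/-- The mean of the stopped log-likelihood ratio S is minus the divergence. It is bounded above
separately on the decision event E and on its complement, where exp S has integral at most δ and at
most 1. -/
theorem information_inequality (π : Policy K U) (v v' : Fin K → ℝ) (σ : ℝ≥0) (hσ : 0 < σ)
    (n : ℕ) (P : Finset (Fin K) → Prop) {δ : ℝ} (hδ : 0 < δ)
    (h : (interactionMeasure π σ).real (decides π v' n P) ≤ δ) :
    (interactionMeasure π σ).real (decides π v n P) * Real.log (1 / δ) - Real.log 2 ≤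
      (∑ t ∈ Finset.range n, ∫ ω, drift π v v' t ω ^ 2 ∂(interactionMeasure π σ)) /
        (2 * (σ : ℝ) ^ 2) := by
  set μ := interactionMeasure π σ with hμ
  set E := decides π v n P with hE
  have hEm : MeasurableSet E := measurableSet_decides π v n P
  set S := stoppedLogRatio π v v' σ n
  have hS : Integrable S μ := integrable_stoppedLogRatio π v v' σ n
  have hZnn : 0 ≤ᵐ[μ] fun ω => Real.exp (S ω) := ae_of_all _ fun ω => (Real.exp_pos _).le
  have hZm : AEStronglyMeasurable (fun ω => Real.exp (S ω)) μ :=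
    Real.continuous_exp.comp_aestronglyMeasurable hS.aestronglyMeasurable
  have hZ1 := lintegral_exp_stoppedLogRatio π v v' σ hσ n
  have hZ : Integrable (fun ω => Real.exp (S ω)) μ := by
    refine ⟨hZm, ?_⟩
    rw [hasFiniteIntegral_iff_ofReal hZnn]
    exact hZ1.trans_lt ENNReal.one_lt_top
  have hZint : ∫ ω, Real.exp (S ω) ∂μ = 1 := by
    rw [integral_eq_lintegral_of_nonneg_ae hZnn hZm, hZ1, ENNReal.toReal_one]
  have hZE : ∫ ω in E, Real.exp (S ω) ∂μ ≤ δ := by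
    rw [integral_eq_lintegral_of_nonneg_ae (ae_restrict_of_ae hZnn) hZm.restrict,
      setLIntegral_exp_stoppedLogRatio π v v' σ hσ n P]
    exact h
  -- The tangent line of the exponential at log α. Taking α = 2δ on E and α = 2 off E makes each
  -- exponential term at most 1/2; these cancel the two -1 terms and leave p log δ + log 2, where p
  -- = P(E).
  have hbound (α : ℝ) (hα : 0 < α) (s : ℝ) : s ≤ Real.exp s / α + (Real.log α - 1) := by
    have := Real.add_one_le_exp (s - Real.log α)
    rw [Real.exp_sub, Real.exp_log hα] at this
    linarith
  have hcompl : ∫ ω in Eᶜ, Real.exp (S ω) ∂μ ≤ 1 :=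
    hZint ▸ setIntegral_le_integral hZ hZnn
  have hi1 : ∫ ω in E, S ω ∂μ ≤ 1 / 2 + μ.real E * (Real.log (2 * δ) - 1) := by
    calc ∫ ω in E, S ω ∂μ
        ≤ ∫ ω in E, (Real.exp (S ω) / (2 * δ) + (Real.log (2 * δ) - 1)) ∂μ :=
          setIntegral_mono hS.integrableOn ((hZ.div_const _).add (integrable_const _)).integrableOn
            fun ω => hbound _ (by positivity) _
      _ = (∫ ω in E, Real.exp (S ω) ∂μ) / (2 * δ) + μ.real E * (Real.log (2 * δ) - 1) := by
          rw [integral_add (hZ.div_const _).integrableOn (integrable_const _), integral_div,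
            setIntegral_const, smul_eq_mul]
      _ ≤ _ := by
          refine add_le_add_left ?_ _
          rw [div_le_div_iff₀ (by positivity) two_pos]
          linarith
  have hi2 : ∫ ω in Eᶜ, S ω ∂μ ≤ 1 / 2 + (1 - μ.real E) * (Real.log 2 - 1) := by
    calc ∫ ω in Eᶜ, S ω ∂μ
        ≤ ∫ ω in Eᶜ, (Real.exp (S ω) / 2 + (Real.log 2 - 1)) ∂μ :=
          setIntegral_mono hS.integrableOn ((hZ.div_const _).add (integrable_const _)).integrableOn
            fun ω => hbound _ two_pos _
      _ = (∫ ω in Eᶜ, Real.exp (S ω) ∂μ) / 2 + (1 - μ.real E) * (Real.log 2 - 1) := by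
          rw [integral_add (hZ.div_const _).integrableOn (integrable_const _), integral_div,
            setIntegral_const, smul_eq_mul, probReal_compl_eq_one_sub hEm]
      _ ≤ _ := add_le_add_left (div_le_div_of_nonneg_right hcompl two_pos.le) _
  have hsum := integral_add_compl hEm hS
  have hval := integral_stoppedLogRatio π v v' σ n
  have hlog : Real.log (2 * δ) = Real.log 2 + Real.log δ :=
    Real.log_mul two_ne_zero hδ.ne'
  rw [hlog] at hi1
  rw [one_div, Real.log_inv]
  change ∫ ω, S ω ∂μ = _ at hval
  rw [hval] at hsum
  linarith

/-! ### Flattening a change point -/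

lemma mem_changePoints {v : Fin K → ℝ} {i : Fin K} :
    i ∈ changePoints v ↔ ∃ h : i.val + 1 < K, v i ≠ v ⟨i.val + 1, h⟩ := by
  simp [changePoints]

/-- The environment in which the arms `x` and `x + 1` are both moved to the midpoint of their
means. -/
def flatten (v : Fin K → ℝ) (x : Fin K) (hx : x.val + 1 < K) : Fin K → ℝ := fun a =>
  if a.val = x.val ∨ a.val = x.val + 1 then (v x + v ⟨x.val + 1, hx⟩) / 2 else v a

/-- By separation, x-1 and x+1 are not change points of `v`, so the outer neighbours of the pair
share the old means of x and x+1. Both differ from the midpoint, which creates the new changes. -/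
lemma mem_changePoints_flatten {v : Fin K → ℝ} {x : Fin K} (hx : x.val + 1 < K)
    (hne : v x ≠ v ⟨x.val + 1, hx⟩)
    (hsep : ∀ y ∈ changePoints v, (x < y → x.val + 2 < y.val) ∧ (y < x → y.val + 2 < x.val))
    (i : Fin K) :
    i ∈ changePoints (flatten v x hx) ↔
      (i ∈ changePoints v ∧ i.val ≠ x.val) ∨ i.val + 1 = x.val ∨
        (i.val = x.val + 1 ∧ i.val + 1 < K) := by
  have hcp : ∀ y : Fin K, ∀ hy : y.val + 1 < K, (x < y ∧ y.val ≤ x.val + 2) ∨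
      (y < x ∧ x.val ≤ y.val + 2) → v y = v ⟨y.val + 1, hy⟩ := by
    intro y hy h
    by_contra hc
    have := hsep y (mem_changePoints.2 ⟨hy, hc⟩)
    rcases h with h | h
    · have := this.1 h.1; omega
    · have := this.2 h.1; omega
  obtain ⟨i, hi⟩ := i
  simp only [mem_changePoints, flatten]
  rcases Nat.lt_or_ge (i + 1) K with hK | hK
  swap
  · constructor
    · rintro ⟨h, -⟩; omega
    · rintro (⟨⟨h, -⟩, -⟩ | h | ⟨-, h⟩)
      · omega
      · have := x.isLt; omega
      · omega
  simp only [hK, exists_true_left, and_true]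
  rcases lt_trichotomy i x.val with h | h | h
  · rw [if_neg (by omega)]
    rcases Nat.lt_or_ge (i + 1) x.val with h1 | h1
    · rw [if_neg (by omega)]
      constructor
      · exact fun h2 => Or.inl ⟨h2, by omega⟩
      · rintro (h2 | h2 | h2)
        · exact h2.1
        · omega
        · omega
    · have h2 : i + 1 = x.val := by omega
      rw [if_pos (by omega)]
      refine iff_of_true ?_ (Or.inr (Or.inl h2))
      have h3 := hcp ⟨i, hi⟩ hK (Or.inr ⟨h, by simp only; omega⟩)
      have h4 : (⟨i + 1, hK⟩ : Fin K) = x := Fin.ext h2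
      simp only [h4] at h3
      rw [h3]
      intro h5
      apply hne
      linarith
  · rw [if_pos (by omega), if_pos (by omega)]
    refine iff_of_false (by simp) ?_
    rintro (h2 | h2 | h2) <;> omega
  · rcases Nat.lt_or_ge (x.val + 1) i with h1 | h1
    · rw [if_neg (by omega), if_neg (by omega)]
      constructor
      · exact fun h2 => Or.inl ⟨h2, by omega⟩
      · rintro (h2 | h2 | h2)
        · exact h2.1
        · omega
        · omega
    · have h2 : i = x.val + 1 := by omega
      subst h2
      rw [if_pos (by omega), if_neg (by omega)]
      refine iff_of_true ?_ (Or.inr (Or.inr rfl))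
      have h3 := hcp ⟨x.val + 1, hi⟩ hK (Or.inl ⟨h, by simp only; omega⟩)
      rw [← h3]
      intro h5
      apply hne
      linarith

/-- An old change point is at distance at least 3 from x, hence at least 2 from the new ones at x-1
and x+1: this is where the stronger separation is needed. -/
lemma exists_flatten_mem_environments {m : ℕ} (hK : 3 ≤ K) {v : Fin K → ℝ}
    (hv : v ∈ environments K m)
    (hsep : ∀ x ∈ changePoints v, ∀ y ∈ changePoints v, x < y → x.val + 2 < y.val)
    {x : Fin K} (hxv : x ∈ changePoints v) (hx : x.val + 1 < K) :
    x ∉ changePoints (flatten v x hx) ∧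
      ∃ m', m ≤ m' ∧ flatten v x hx ∈ environments K m' := by
  classical
  obtain ⟨_, hne⟩ := mem_changePoints.1 hxv
  have hsx : ∀ y ∈ changePoints v,
      (x < y → x.val + 2 < y.val) ∧ (y < x → y.val + 2 < x.val) :=
    fun y hy => ⟨hsep x hxv y hy, hsep y hy x hxv⟩
  have hmem := mem_changePoints_flatten hx hne hsx
  refine ⟨?_, _, ?_, rfl, ?_⟩
  · rw [hmem]
    omega
  · rw [← hv.1]
    -- One new change point suffices to make up for the loss of x. It is x-1, or x+1 when x is the
    -- first arm, and the latter has a right neighbour because K ≥ 3.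
    obtain ⟨z, hz⟩ : ∃ z : Fin K, z.val + 1 = x.val ∨ (z.val = x.val + 1 ∧ z.val + 1 < K) := by
      rcases Nat.eq_zero_or_pos x.val with h | h
      · exact ⟨⟨x.val + 1, hx⟩, Or.inr ⟨rfl, by simp only; omega⟩⟩
      · exact ⟨⟨x.val - 1, by omega⟩, Or.inl (by simp only; omega)⟩
    have hzv : z ∉ (changePoints v).erase x := by
      intro h
      have h1 := hsx z (Finset.mem_of_mem_erase h)
      simp only [Fin.lt_def] at h1
      omega
    calc (changePoints v).card = ((changePoints v).erase x).card + 1 :=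
          (Finset.card_erase_add_one hxv).symm
      _ = (insert z ((changePoints v).erase x)).card := (Finset.card_insert_of_notMem hzv).symm
      _ ≤ _ := Finset.card_le_card fun i hi => by
          rw [hmem]
          rcases Finset.mem_insert.1 hi with rfl | hi
          · exact Or.inr hz
          · exact Or.inl ⟨Finset.mem_of_mem_erase hi,
              fun h => Finset.ne_of_mem_erase hi (Fin.ext h)⟩
  · intro i hi j hj hij
    rw [hmem] at hi hj
    rw [Fin.lt_def] at hij
    rcases hi with ⟨hi, hi'⟩ | hi | hi <;> rcases hj with ⟨hj, hj'⟩ | hj | hj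
    · exact hv.2 i hi j hj hij
    · have := hsx i hi; simp only [Fin.lt_def] at this; omega
    · have := hsx i hi; simp only [Fin.lt_def] at this; omega
    · have := hsx j hj; simp only [Fin.lt_def] at this; omega
    · omega
    · omega
    · have := hsx j hj; simp only [Fin.lt_def] at this; omega
    · omega
    · omega

lemma sub_flatten_sq (v : Fin K → ℝ) (x : Fin K) (hx : x.val + 1 < K) (a : Fin K) :
    (v a - flatten v x hx a) ^ 2 =
      if a.val = x.val ∨ a.val = x.val + 1 then jump v x ^ 2 / 4 else 0 := by
  unfold flatten
  split_ifs with h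
  · rw [jump, dif_pos hx, sq_abs]
    rcases h with h | h
    · obtain rfl : a = x := Fin.ext h
      ring
    · obtain rfl : a = ⟨x.val + 1, hx⟩ := Fin.ext h
      ring
  · ring

lemma jump_pos {v : Fin K → ℝ} {x : Fin K} (hx : x ∈ changePoints v) : 0 < jump v x := by
  obtain ⟨h, hne⟩ := mem_changePoints.1 hx
  rw [jump, dif_pos h]
  exact abs_pos.2 (sub_ne_zero.2 hne)

/-! ### Ordered jumps -/

lemma getElem_le_getElem_of_sublist {l₁ l₂ : List ℝ} (h : l₁.Sublist l₂)
    (hl : l₂.Pairwise (· ≥ ·)) (i : ℕ) (hi : i < l₁.length) :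
    l₁[i] ≤ l₂[i]'(hi.trans_le h.length_le) := by
  induction h generalizing i with
  | slnil => simp at hi
  | @cons l₁ l₂ a h ih =>
    refine (ih hl.of_cons i hi).trans ?_
    have hi2 : i < l₂.length := hi.trans_le h.length_le
    cases i with
    | zero => exact List.rel_of_pairwise_cons hl (List.getElem_mem hi2)
    | succ i =>
      exact List.pairwise_iff_getElem.1 hl.of_cons i (i + 1) (by omega) hi2 (by omega)
  | cons_cons a h ih =>
    cases i with
    | zero => exact le_rfl
    | succ i => exact ih hl.of_cons i (by simpa using hi)

/-- The sorted jumps over S form a sublist of all sorted jumps, and the i-th entry of a sublist of a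
decreasing list is at most the i-th entry of the list. -/
lemma sum_orderedJump_le {v : Fin K → ℝ} {S : Finset (Fin K)} (hS : S ⊆ changePoints v) :
    ∑ i ∈ Finset.range S.card, 1 / orderedJump v i ^ 2 ≤ ∑ x ∈ S, 1 / jump v x ^ 2 := by
  set l : List ℝ := (S.val.map (jump v)).sort (· ≥ ·) with hl
  have hlen : l.length = S.card := by simp [hl]
  have hle : S.val.map (jump v) ≤ (changePoints v).val.map (jump v) :=
    Multiset.map_le_map (Finset.val_le_iff.2 hS)
  have hsub : l.Sublist (sortedJumps v) := by
    refine List.sublist_of_subperm_of_pairwise ?_ (Multiset.pairwise_sort _ _)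
      (Multiset.pairwise_sort _ _)
    rw [← Multiset.coe_le]
    simpa [hl, sortedJumps, Multiset.sort_eq] using hle
  have hsum : ∑ x ∈ S, 1 / jump v x ^ 2 = (l.map fun r => 1 / r ^ 2).sum := by
    rw [Finset.sum_eq_multiset_sum, ← Multiset.sum_coe, ← Multiset.map_coe, hl,
      Multiset.sort_eq, Multiset.map_map]
    rfl
  have hpos : ∀ r ∈ l, 0 < r := by
    intro r hr
    rw [hl, Multiset.mem_sort, Multiset.mem_map] at hr
    obtain ⟨x, hx, rfl⟩ := hr
    exact jump_pos (hS hx)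
  rw [hsum, ← hlen, Finset.sum_range, ← Fin.sum_univ_fun_getElem]
  refine Finset.sum_le_sum fun i _ => ?_
  have h1 := getElem_le_getElem_of_sublist hsub (Multiset.pairwise_sort _ _) i i.isLt
  have h2 : orderedJump v i = (sortedJumps v)[i]'(i.isLt.trans_le hsub.length_le) :=
    List.getD_eq_getElem _ _ _
  have h3 := hpos _ (List.getElem_mem i.isLt)
  rw [h2]
  exact one_div_le_one_div_of_le (pow_pos h3 2) (pow_le_pow_left₀ h3.le h1 2)

/-! ### The lower bound -/

lemma sum_measure_lt_stoppingTime_le (π : Policy K U) (v : Fin K → ℝ) (σ : ℝ≥0) (n : ℕ) :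
    ENNReal.ofReal (∑ t ∈ Finset.range n,
      (interactionMeasure π σ).real {ω | (t : ℕ∞) < stoppingTime π v ω}) ≤
      expectedStoppingTime π σ v := by
  have hm := measurableSet_lt_stoppingTime π v
  rw [ENNReal.ofReal_sum_of_nonneg fun _ _ => measureReal_nonneg]
  simp only [Measure.real, ENNReal.ofReal_toReal (measure_ne_top _ _)]
  rw [Finset.sum_congr rfl fun t _ => (lintegral_indicator_one (hm t)).symm,
    ← lintegral_finsetSum _ fun t _ => measurable_one.indicator (hm t)]
  refine lintegral_mono fun ω => ?_
  rcases eq_or_ne (stoppingTime π v ω) ⊤ with h | h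
  · simp [h]
  · obtain ⟨k, hk⟩ := ENat.ne_top_iff_exists.1 h
    simp only [← hk, Set.indicator_apply, Set.mem_ofPred_eq, Nat.cast_lt, Pi.one_apply,
      Finset.sum_boole, ENat.toENNReal_coe]
    refine Nat.cast_le.2 ((Finset.card_le_card fun t ht => ?_).trans_eq (Finset.card_range k))
    exact Finset.mem_range.2 (Finset.mem_filter.1 ht).2

/-- The events of deciding before n increase to an event that is almost surely the event on the
estimate, so continuity from below applies. -/
lemma exists_lt_measure_decides (π : Policy K U) (v : Fin K → ℝ) (σ : ℝ≥0)
    (P : Finset (Fin K) → Prop) {c : ℝ}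
    (hc : c < (interactionMeasure π σ).real {ω | P (estimate π v ω)})
    (hτ : interactionMeasure π σ {ω | stoppingTime π v ω < ⊤} = 1) :
    ∃ n, c < (interactionMeasure π σ).real (decides π v n P) := by
  set μ := interactionMeasure π σ
  have hU (Q : Finset (Fin K) → Prop) :
      ⋃ n, decides π v n Q = {ω | stoppingTime π v ω < ⊤ ∧ Q (estimate π v ω)} := by
    ext ω
    simp only [decides, Set.mem_iUnion, Set.mem_ofPred_eq, exists_and_right]
    refine and_congr_left fun _ => ⟨fun ⟨n, hn⟩ => hn.trans_le le_top, fun h => ?_⟩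
    obtain ⟨k, hk⟩ := ENat.ne_top_iff_exists.1 h.ne
    exact ⟨k + 1, by rw [← hk]; exact_mod_cast k.lt_succ_self⟩
  have hmono : Monotone fun n => decides π v n P := fun a b hab ω hω =>
    ⟨hω.1.trans_le (Nat.cast_le.2 hab), hω.2⟩
  have hlim := tendsto_measure_iUnion_atTop (μ := μ) hmono
  have hae : ∀ᵐ ω ∂μ, stoppingTime π v ω < ⊤ := by
    refine (mem_ae_iff_prob_eq_one ?_).2 hτ
    have h := hU fun _ => True
    simp only [and_true] at h
    rw [← h]
    exact MeasurableSet.iUnion fun n => measurableSet_decides π v n _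
  have heq : μ (⋃ n, decides π v n P) = μ {ω | P (estimate π v ω)} := by
    rw [hU]
    refine measure_congr ?_
    filter_upwards [hae] with ω hω
    exact propext ⟨fun h => h.2, fun h => ⟨hω, h⟩⟩
  rw [heq] at hlim
  have hlim' := (ENNReal.tendsto_toReal (measure_ne_top μ _)).comp hlim
  exact (hlim'.eventually (lt_mem_nhds hc)).exists

lemma measure_decides_le_of_disjoint (π : Policy K U) (v : Fin K → ℝ) (σ : ℝ≥0) (n : ℕ)
    (P Q : Finset (Fin K) → Prop) (hPQ : ∀ S, P S → ¬ Q S) {δ : ℝ}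
    (h : 1 - δ < (interactionMeasure π σ).real {ω | Q (estimate π v ω)}) :
    (interactionMeasure π σ).real (decides π v n P) ≤ δ := by
  have h1 : {ω | Q (estimate π v ω)} ⊆ (decides π v n P)ᶜ :=
    fun ω hω hd => hPQ _ hd.2 hω
  have h2 := measureReal_mono (μ := interactionMeasure π σ) h1
  rw [probReal_compl_eq_one_sub (measurableSet_decides π v n P)] at h2
  linarith

/-- The event that `π` has not stopped by round `t` and then plays arm `x` or `x + 1`. -/
def plays (π : Policy K U) (v : Fin K → ℝ) (t : ℕ) (x : Fin K) : Set (U × (ℕ → ℝ)) :=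
  {ω | (t : ℕ∞) < stoppingTime π v ω ∧
    ((action π v t ω).val = x.val ∨ (action π v t ω).val = x.val + 1)}

lemma measurableSet_plays (π : Policy K U) (v : Fin K → ℝ) (t : ℕ) (x : Fin K) :
    MeasurableSet (plays π v t x) :=
  (measurableSet_lt_stoppingTime π v t).inter
    (measurable_action π v t (t := {a : Fin K | a.val = x.val ∨ a.val = x.val + 1})
      (Set.to_countable _).measurableSet)

lemma integral_drift_flatten_sq (π : Policy K U) (v : Fin K → ℝ) (σ : ℝ≥0) (t : ℕ)
    (x : Fin K) (hx : x.val + 1 < K) :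
    ∫ ω, drift π v (flatten v x hx) t ω ^ 2 ∂(interactionMeasure π σ) =
      (interactionMeasure π σ).real (plays π v t x) * (jump v x ^ 2 / 4) := by
  rw [← smul_eq_mul, ← integral_indicator_const _ (measurableSet_plays π v t x)]
  refine integral_congr_ae (ae_of_all _ fun ω => ?_)
  simp only [drift, Set.indicator_apply, plays, Set.mem_ofPred_eq]
  by_cases h : (t : ℕ∞) < stoppingTime π v ω
  · simp only [h, if_true, true_and]
    exact sub_flatten_sq v x hx _
  · simp [h]

/-- Separation makes the pairs {x, x+1} disjoint, so a single action counts for at most one change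
point. -/
lemma sum_measure_plays_le (π : Policy K U) {v : Fin K → ℝ} {m : ℕ}
    (hv : v ∈ environments K m) (σ : ℝ≥0) (t : ℕ) :
    ∑ x ∈ changePoints v, (interactionMeasure π σ).real (plays π v t x) ≤
      (interactionMeasure π σ).real {ω | (t : ℕ∞) < stoppingTime π v ω} := by
  rw [← measureReal_biUnion_finset _ fun x _ => measurableSet_plays π v t x]
  · exact measureReal_mono (Set.iUnion₂_subset fun x _ ω h => h.1)
  · intro x hx y hy hxy
    refine Set.disjoint_left.2 fun ω h1 h2 => ?_
    have h3 := h1.2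
    have h4 := h2.2
    rcases lt_or_gt_of_ne hxy with h | h
    · have := hv.2 x hx y hy h; omega
    · have := hv.2 y hy x hx h; omega

lemma measure_decides_mul_sum_le (π : Policy K U) (v : Fin K → ℝ) (σ : ℝ≥0) {N : ℕ}
    (hN : ∀ n h, (π.recommend n h).card = N) (n : ℕ) :
    (interactionMeasure π σ).real (decides π v n (· ⊆ changePoints v)) *
        ∑ i ∈ Finset.range N, 1 / orderedJump v i ^ 2 ≤
      ∑ x ∈ changePoints v,
        (interactionMeasure π σ).real (decides π v n (x ∈ ·)) * (1 / jump v x ^ 2) := by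
  have hm (P : Finset (Fin K) → Prop) := measurableSet_decides π v n P
  have hint (P : Finset (Fin K) → Prop) (c : ℝ) :
      Integrable ((decides π v n P).indicator fun _ => c) (interactionMeasure π σ) :=
    (integrable_const c).indicator (hm P)
  -- Each probability times a constant becomes the integral of an indicator, which reduces the claim
  -- to a pointwise one. On a correct decision, the sum over the recommended set is at least the
  -- ordered sum.
  simp only [← smul_eq_mul, ← fun P (c : ℝ) =>
    integral_indicator_const (μ := interactionMeasure π σ) c (hm P)]
  rw [← integral_finsetSum _ fun x _ => hint _ _]
  refine integral_mono (hint _ _) (integrable_finsetSum _ fun x _ => hint _ _) fun ω => ?_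
  have hnn : ∀ x ∈ changePoints v,
      0 ≤ (decides π v n (x ∈ ·)).indicator (fun _ => 1 / jump v x ^ 2) ω :=
    fun x _ => Set.indicator_nonneg (fun _ _ => by positivity) ω
  by_cases h : ω ∈ decides π v n (· ⊆ changePoints v)
  · have h1 := sum_orderedJump_le h.2
    rw [show (estimate π v ω).card = N from hN _ _] at h1
    simp only [Set.indicator_of_mem h]
    refine h1.trans ?_
    refine le_trans (Finset.sum_le_sum fun x hx => ?_)
      (Finset.sum_le_sum_of_subset_of_nonneg h.2 fun x hx _ => hnn x hx)
    exact (Set.indicator_of_mem (s := decides π v n (x ∈ ·)) ⟨h.1, hx⟩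
      fun _ => 1 / jump v x ^ 2).ge
  · simp only [Set.indicator_of_notMem h]
    exact Finset.sum_nonneg hnn

end PiecewiseBandit

end

theorem mainTheorem2 {U : Type*} [MeasurableSpace U] {K N m : ℕ} (hK : 3 ≤ K)
    (hNm : N ≤ m) (hmK : m < K) (σ : ℝ≥0) (hσ : 0 < σ) (δ : ℝ) (hδ₀ : 0 < δ) (hδ₁ : δ < 1)
    (π : PiecewiseBandit.Policy K U) (hπ : PiecewiseBandit.IsAnyPolicy π σ N δ)
    (v : Fin K → ℝ) (hv : v ∈ PiecewiseBandit.environments K m)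
    (hsep : ∀ x ∈ PiecewiseBandit.changePoints v, ∀ y ∈ PiecewiseBandit.changePoints v,
      x < y → x.val + 2 < y.val) :
    ENNReal.ofReal
      (8 * (σ : ℝ) ^ 2 * (1 - δ) * Real.log (1 / δ) *
          (∑ i ∈ Finset.range N, 1 / PiecewiseBandit.orderedJump v i ^ 2) -
        8 * (σ : ℝ) ^ 2 * Real.log 2 *
          (∑ x ∈ PiecewiseBandit.changePoints v, 1 / PiecewiseBandit.jump v x ^ 2)) ≤
      PiecewiseBandit.expectedStoppingTime π σ v := by
  open PiecewiseBandit in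
  obtain ⟨hgood, hτ⟩ := hπ.2 m hNm v hv
  obtain ⟨n, hn⟩ := exists_lt_measure_decides π v σ (· ⊆ changePoints v) hgood hτ
  refine le_trans (ENNReal.ofReal_le_ofReal ?_) (sum_measure_lt_stoppingTime_le π v σ n)
  set μ := interactionMeasure π σ
  have hL : 0 ≤ Real.log (1 / δ) := Real.log_nonneg (one_le_one_div hδ₀ hδ₁.le)
  have hx : ∀ x ∈ changePoints v,
      8 * (σ : ℝ) ^ 2 * ((μ.real (decides π v n (x ∈ ·)) * (1 / jump v x ^ 2)) *
        Real.log (1 / δ) - Real.log 2 * (1 / jump v x ^ 2)) ≤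
        ∑ t ∈ Finset.range n, μ.real (plays π v t x) := by
    intro x hxv
    obtain ⟨hxK, -⟩ := mem_changePoints.1 hxv
    obtain ⟨hx', m', hm', hv'⟩ := exists_flatten_mem_environments hK hv hsep hxv hxK
    have h1 := measure_decides_le_of_disjoint π (flatten v x hxK) σ n (x ∈ ·)
      (· ⊆ changePoints (flatten v x hxK)) (fun S hS hc => hx' (hc hS))
      (hπ.2 m' (hNm.trans hm') _ hv').1
    have h2 := information_inequality π v (flatten v x hxK) σ hσ n (x ∈ ·) hδ₀ h1
    simp only [integral_drift_flatten_sq] at h2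
    rw [← Finset.sum_mul] at h2
    have hj := jump_pos hxv
    have hσ' : (0 : ℝ) < σ := hσ
    -- The divergence is the expected number of pulls times (Δ²/4)/(2σ²), so the factor 8σ²/Δ²
    -- isolates the number of pulls.
    have h3 := mul_le_mul_of_nonneg_left h2
      (show 0 ≤ 8 * (σ : ℝ) ^ 2 * (1 / jump v x ^ 2) by positivity)
    refine le_trans (le_of_eq ?_) (h3.trans (le_of_eq ?_))
    · ring
    · field_simp
      ring
  calc _ ≤ 8 * (σ : ℝ) ^ 2 * Real.log (1 / δ) *
          (∑ x ∈ changePoints v, μ.real (decides π v n (x ∈ ·)) * (1 / jump v x ^ 2)) -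
        8 * (σ : ℝ) ^ 2 * Real.log 2 * (∑ x ∈ changePoints v, 1 / jump v x ^ 2) := by
        refine sub_le_sub_right ?_ _
        have h1 := (mul_le_mul_of_nonneg_right hn.le
          (Finset.sum_nonneg fun i _ => by positivity)).trans
          (measure_decides_mul_sum_le π v σ hπ.1 n)
        have h2 := mul_le_mul_of_nonneg_left h1
          (show 0 ≤ 8 * (σ : ℝ) ^ 2 * Real.log (1 / δ) by positivity)
        refine le_trans (le_of_eq ?_) h2
        ring
    _ = ∑ x ∈ changePoints v, 8 * (σ : ℝ) ^ 2 *
        ((μ.real (decides π v n (x ∈ ·)) * (1 / jump v x ^ 2)) *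
        Real.log (1 / δ) - Real.log 2 * (1 / jump v x ^ 2)) := by
        rw [← Finset.mul_sum, Finset.sum_sub_distrib, ← Finset.sum_mul, ← Finset.mul_sum]
        ring
    _ ≤ ∑ x ∈ changePoints v, ∑ t ∈ Finset.range n, μ.real (plays π v t x) :=
        Finset.sum_le_sum hx
    _ = ∑ t ∈ Finset.range n, ∑ x ∈ changePoints v, μ.real (plays π v t x) :=
        Finset.sum_comm
    _ ≤ _ := Finset.sum_le_sum fun t _ => sum_measure_plays_le π hv σ t
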